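/- **Theorem (Weyl anomaly of Liouville quantum field theory on tori).** *Setting.* Let $\mathbb T=\mathbb R^2/\mathbb Z^2$ with its standard volume $\lambda$, and $\tau\in\mathbb H$. Let $\hat g_\tau=|dx_1+\tau\,dx_2|^2$, with volume form $d\lambda_\tau=\mathrm{Im}(\tau)\,d\lambda$, Laplacian $\triangle_\tau=\mathrm{Im}(\tau)^{-2}(|\tau|^2\partial_{11}-2\mathrm{Re}(\tau)\partial_{12}+\partial_{22})$ and gradient $\partial^\tau=\mathrm{Im}(\tau)^{-2}(|\tau|^2\partial_1-\mathrm{Re}(\tau)\partial_2,\,-\mathrm{Re}(\tau)\partial_1+\partial_2)$; $|v|_\tau=|v_1+\tau v_2|$ is the length in $\hat g_\tau$. For $\psi(z)=\frac{az+b}{cz+d}$ with $\begin{pmatrix}a&b\\c&d\end{pmatrix}\in SL_2(\mathbb Z)$ put $\widetilde\psi(x)=(dx_1+bx_2,\,cx_1+ax_2)$. A *modular log-conformal factor* is a measurable map $\tau\in\mathbb H\mapsto\varphi_\tau\in H^1(\mathbb T)$ (real-valued) with $\varphi_{\psi(\tau)}=\varphi_\tau\circ\widetilde\psi$ for all $\psi$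 and $\tau$, and such that $\tau\mapsto\int_{\mathbb T}|\partial^\tau\varphi_\tau|_\tau^2\,d\lambda_\tau$ is invariant under the modular group. Let $X_\tau$ be the Gaussian free field with vanishing mean for $\hat g_\tau$, i.e. the centred real Gaussian random distribution $$X_\tau=\sum_{k=(n,m)\in\mathbb Z^2\setminus\{0\}}\alpha_k\,c_k(\tau)^{1/2}e^{2\pi i k\cdot x},\qquad c_k(\tau)=\frac{\mathrm{Im}(\tau)}{2\pi|n\tau-m|^2},$$ where the $\alpha_k$ are jointly Gaussian standard complex variables with $\alpha_{-k}=\overline{\alpha_k}$ and $\mathbb E[\alpha_k\overline{\alpha_l}]=\delta_{kl}$. For $g_\tau=e^{\varphi_\tau}\hat g_\tau$ put $d\lambda_{g_\tau}=e^{\varphi_\tau}d\lambda_\tau$, let $X_{g_\tau}=X_\tau-\lambda_{g_\tau}(\mathbb T)^{-1}\int_{\mathbb T}X_\tau\,d\lambda_{g_\tau}$ be the free field with vanishing mean for $g_\tau$, let $R_{g_\tau}=-e^{-\varphi_\tau}\triangle_\tau\varphi_\tau$ (so that $R_{g_\tau}d\lambda_{g_\tau}=-\triangle_\tau\varphi_\tau\,d\lambda_\tau$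 as a distribution), and let $$Z^{\rm FF}(g_\tau)=e^{\frac1{96\pi}\int_{\mathbb T}|\partial^\tau\varphi_\tau|^2_\tau d\lambda_\tau}\,\frac{1}{\sqrt{\mathrm{Im}(\tau)}\,|\eta(\tau)|^{2}},\qquad \eta \text{ the Dedekind function.}$$ A subscript $\epsilon$ denotes the average over circles of radius $\epsilon$ of the metric $\hat g_\tau$: $f_\epsilon(x)=\frac1{2\pi}\int_0^{2\pi}f(x+c_\tau(\epsilon e^{i\theta}))\,d\theta$ with $c_\tau(w)=\big(\mathrm{Re}\,w-\tfrac{\mathrm{Re}\,\tau}{\mathrm{Im}\,\tau}\mathrm{Im}\,w,\ \tfrac{\mathrm{Im}\,w}{\mathrm{Im}\,\tau}\big)$. Let $\gamma\in\,]0,2[$, $Q=\frac2\gamma+\frac\gamma2$, $\mu>0$, let $z_1,\dots,z_n\in\mathbb T$ be distinct, $\alpha_1,\dots,\alpha_n\in\mathbb R$, and $F:H^{-1}(\mathbb T)\to\mathbb R$ bounded and (Borel) measurable. With $$\phi_{\epsilon}=c+X_{g_\tau,\epsilon}-\tfrac Q2\ln\mathrm{Im}(\tau)+\tfrac Q2\varphi_{\tau,\epsilon}$$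 set $$\Pi(g_\tau,F,\epsilon)=Z^{\rm FF}(g_\tau)\int_{\mathbb R}\mathbb E\Big[F(\phi_\epsilon)\prod_{i=1}^n\epsilon^{\alpha_i^2/2}e^{\alpha_i\phi_\epsilon(z_i)}\exp\Big(-\frac Q{4\pi}\int_{\mathbb T}R_{g_\tau}(c+X_{g_\tau})\,d\lambda_{g_\tau}-\mu\,\epsilon^{\gamma^2/2}\int_{\mathbb T}e^{\gamma\phi_\epsilon}\,d\lambda_\tau\Big)\Big]dc .$$ The limit $\Pi(g_\tau,F)=\lim_{\epsilon\to0}\Pi(g_\tau,F,\epsilon)$ is said to *exist and be non-trivial* if the integral (over $dc\otimes\mathbb P$) converges absolutely for all small $\epsilon>0$ and $\Pi(g_\tau,F,\epsilon)$ converges to an element of $]0,+\infty[$. The case of $\hat g_\tau$ is that of $\varphi_\tau=0$. *Theorem.* Let $\varphi$ be a modular log-conformal factor, $\tau\in\mathbb H$ and $g_\tau=e^{\varphi_\tau}\hat g_\tau$. Then $\Pi(g_\tau,F)$ exists and is non-trivial if and only if $\Pi(\hat g_\tau,F)$ exists and is non-trivial. In that case $$\ln\frac{\Pi(g_\tau,F)}{\Pi(\hat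 g_\tau,F)}=\frac{1+6Q^2}{96\pi}\int_{\mathbb T}|\partial^\tau\varphi_\tau|_\tau^2\,d\lambda_\tau .$$ In particular the central charge is $1+6Q^2$: if $\int_{\mathbb T}|\partial^\tau\varphi_\tau|^2_\tau\,d\lambda_\tau\neq0$, it is the only number $c_L$ for which $\ln\frac{\Pi(g_\tau,F)}{\Pi(\hat g_\tau,F)}=\frac{c_L}{96\pi}\int_{\mathbb T}|\partial^\tau\varphi_\tau|_\tau^2\,d\lambda_\tau$. -/

import Mathlib

open MeasureTheory Filter Topology UpperHalfPlane
open scoped ComplexConjugate MatrixGroups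

noncomputable section

namespace LQFT

/-! ### The fixed torus and its family of flat metrics -/

/-- The torus `𝕋 = ℝ²/ℤ²`. -/
abbrev Torus : Type := UnitAddTorus (Fin 2)

/-- The standard volume `λ = dx₁ dx₂` on the torus, of total mass one. -/
abbrev lam : Measure Torus := Measure.pi fun _ => AddCircle.haarAddCircle

/-- Frequencies `k = (n, m) ∈ ℤ²`. -/
abbrev Freq : Type := Fin 2 → ℤ

/-- The volume form `dλ_τ = Im τ dλ` of the flat metric `ĝ_τ = |dx₁ + τ dx₂|²`. -/
def volTau (τ : ℍ) : Measure Torus := ENNReal.ofReal τ.im • lam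

/-- The gradient in the metric `ĝ_τ` of a function with partial derivatives `p = ∂₁f`, `q = ∂₂f`. -/
def gradTau (τ : ℍ) (p q : ℝ) : ℝ × ℝ :=
  ((τ.im ^ 2)⁻¹ * (‖(τ : ℂ)‖ ^ 2 * p - τ.re * q), (τ.im ^ 2)⁻¹ * (-τ.re * p + q))

/-- The squared length `|v₁ + τ v₂|²` of a tangent vector in the metric `ĝ_τ`. -/
def normSqTau (τ : ℍ) (v : ℝ × ℝ) : ℝ := ‖(v.1 : ℂ) + (τ : ℂ) * (v.2 : ℂ)‖ ^ 2

/-- The linear automorphism `ψ̃(x₁, x₂) = (d x₁ + b x₂, c x₁ + a x₂)` of the torus attached to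
`ψ(z) = (a z + b) / (c z + d)`. -/
def modularMap (ψ : SL(2, ℤ)) (x : Torus) : Torus :=
  ![ψ 1 1 • x 0 + ψ 0 1 • x 1, ψ 1 0 • x 0 + ψ 0 0 • x 1]

/-! ### Sobolev spaces -/

/-- Fourier coefficients `∫ f e^{-2πi k·x} dλ` of a real-valued function. -/
def fourierCoeffReal (f : Torus → ℝ) (k : Freq) : ℂ :=
  UnitAddTorus.mFourierCoeff (fun x => (f x : ℂ)) k

lemma integrable_ofReal_Lp (f : Lp ℝ 2 lam) :
    Integrable (fun x => (f x : ℂ)) lam :=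
  ((Lp.memLp f).integrable (by norm_num)).ofReal

lemma fourierCoeffReal_add (f g : Lp ℝ 2 lam) (k : Freq) :
    fourierCoeffReal (f + g : Lp ℝ 2 lam) k =
      fourierCoeffReal f k + fourierCoeffReal g k := by
  have hi : ∀ h : Lp ℝ 2 lam,
      Integrable (fun x => UnitAddTorus.mFourier (-k) x • (h x : ℂ)) lam := by
    intro h
    refine (integrable_ofReal_Lp h).bdd_mul (c := 1)
      (UnitAddTorus.mFourier (-k)).continuous.aestronglyMeasurable (ae_of_all _ fun x => ?_)
    exact ((UnitAddTorus.mFourier (-k)).norm_coe_le_norm x).trans_eq UnitAddTorus.mFourier_norm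
  unfold fourierCoeffReal UnitAddTorus.mFourierCoeff
  refine Eq.trans ?_ (integral_add (hi f) (hi g))
  refine integral_congr_ae (μ := lam) ?_
  filter_upwards [Lp.coeFn_add f g] with x hx
  rw [hx]
  simp only [Pi.add_apply, Complex.ofReal_add, smul_add]

lemma fourierCoeffReal_smul (r : ℝ) (f : Lp ℝ 2 lam) (k : Freq) :
    fourierCoeffReal (r • f : Lp ℝ 2 lam) k =
      (r : ℂ) * fourierCoeffReal f k := by
  unfold fourierCoeffReal UnitAddTorus.mFourierCoeff
  refine Eq.trans ?_ (integral_const_mul (μ := lam) _ _)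
  refine integral_congr_ae (μ := lam) ?_
  filter_upwards [Lp.coeFn_smul r f] with x hx
  simp [hx]
  ring

lemma fourierCoeffReal_zero (k : Freq) :
    fourierCoeffReal (0 : Lp ℝ 2 lam) k = 0 := by
  simpa using fourierCoeffReal_smul 0 0 k

/-- The real Sobolev space `H¹(𝕋)`, as a subspace of `L² × (L²)²`: a function `φ ∈ L²` together with its weak partial derivatives
`∂₁φ, ∂₂φ ∈ L²` (which `φ` determines), the weak derivatives being characterised by integration by
parts against all characters `e^{-2πi k·x}`. -/
def h1Submodule : Submodule ℝ (Lp ℝ 2 lam ×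
    (Fin 2 → Lp ℝ 2 lam)) where
  carrier := {u | ∀ (j : Fin 2) (k : Freq),
    fourierCoeffReal (u.2 j) k = 2 * Real.pi * Complex.I * (k j : ℂ) * fourierCoeffReal u.1 k}
  add_mem' := by
    intro u v hu hv j k
    have h1 := hu j k
    have h2 := hv j k
    simp only [Prod.fst_add, Prod.snd_add, Pi.add_apply, fourierCoeffReal_add, h1, h2]
    ring
  zero_mem' := by
    intro j k
    simp only [Prod.fst_zero, Prod.snd_zero, Pi.zero_apply, fourierCoeffReal_zero, mul_zero]
  smul_mem' := by
    intro r u hu j k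
    have h1 := hu j k
    simp only [Prod.smul_fst, Prod.smul_snd, Pi.smul_apply, fourierCoeffReal_smul, h1]
    ring

/-- The real Sobolev space `H¹(𝕋)`, normed through the `L²` norms of `φ, ∂₁φ, ∂₂φ`. -/
abbrev H1 : Type := ↥h1Submodule

/-- The function underlying an element of `H¹(𝕋)`. -/
def H1.fn (φ : H1) : Torus → ℝ := φ.1.1

/-- Its weak partial derivatives. -/
def H1.deriv (φ : H1) (j : Fin 2) : Torus → ℝ := φ.1.2 j

/-- Its Fourier coefficients. -/
def H1.coeff (φ : H1) (k : Freq) : ℂ := fourierCoeffReal φ.fn k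

/-- The Dirichlet energy `∫ |∂^τ φ|²_τ dλ_τ`. -/
def dirichletEnergy (τ : ℍ) (φ : H1) : ℝ :=
  ∫ x, normSqTau τ (gradTau τ (φ.deriv 0 x) (φ.deriv 1 x)) ∂(volTau τ)

/-- The dual Sobolev space `H⁻¹(𝕋)`. -/
abbrev HNegOne : Type := StrongDual ℝ H1

/-- Modular log-conformal factors. -/
structure IsModularLogConformalFactor (φ : ℍ → H1) : Prop where
  measurable : Measurable[inferInstance, borel H1] φ
  comp_modularMap : ∀ (ψ : SL(2, ℤ)) (τ : ℍ),
    (φ (ψ • τ)).fn =ᵐ[lam] fun x => (φ τ).fn (modularMap ψ x)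
  energy_invariant : ∀ (ψ : SL(2, ℤ)) (τ : ℍ),
    dirichletEnergy (ψ • τ) (φ (ψ • τ)) = dirichletEnergy τ (φ τ)

/-! ### Distributions through their Fourier coefficients

A real distribution `f` on the torus is given by its coefficients `f_k`, that is
`f = ∑ f_k e^{2πi k·x}`. The series below are limits of square partial sums. -/

/-- The square `{k : |k₁| ≤ N, |k₂| ≤ N}`. -/
def box (N : ℕ) : Finset Freq := Finset.Icc (fun _ => -(N : ℤ)) (fun _ => (N : ℤ))

/-- The pairing `∫ f u dλ = ∑ f_k conj(u_k)`. -/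
def pairing (f u : Freq → ℂ) : ℝ :=
  limUnder atTop fun N : ℕ => (∑ k ∈ box N, f k * conj (u k)).re

/-- The value `f(x) = ∑ f_k e^{2πi k·x}`. -/
def evalAt (f : Freq → ℂ) (x : Torus) : ℝ :=
  limUnder atTop fun N : ℕ => (∑ k ∈ box N, f k * UnitAddTorus.mFourier k x).re

open Classical in
/-- The element `u ↦ ∫ f u dλ` of `H⁻¹(𝕋)` with Fourier coefficients `f_k` (and `0` if the `f_k` are
not the coefficients of an element of `H⁻¹(𝕋)`). -/
def toHNegOne (f : Freq → ℂ) : HNegOne :=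
  if h : ∃ L : HNegOne, ∀ u : H1,
      Tendsto (fun N : ℕ => (∑ k ∈ box N, f k * conj (u.coeff k)).re) atTop (𝓝 (L u))
  then h.choose else 0

/-- Coefficients of the constant `r`. -/
def constCoeff (r : ℝ) : Freq → ℂ := fun k => if k = 0 then (r : ℂ) else 0

/-- The point `c_τ(w) = (Re w - (Re τ / Im τ) Im w, Im w / Im τ)`, so that `{x + c_τ(ε e^{iθ})}` is
the circle of centre `x` and radius `ε` in the metric `ĝ_τ`. -/
def circlePoint (τ : ℍ) (w : ℂ) : Torus :=
  ![((w.re - τ.re / τ.im * w.im : ℝ) : UnitAddCircle), ((w.im / τ.im : ℝ) : UnitAddCircle)]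

/-- The average of the character `e^{2πi k·x}` over the circle of centre `0` and radius `ε`. -/
def circleMultiplier (τ : ℍ) (ε : ℝ) (k : Freq) : ℂ :=
  ((2 * Real.pi : ℝ) : ℂ)⁻¹ * ∫ θ in (0 : ℝ)..(2 * Real.pi),
    UnitAddTorus.mFourier k (circlePoint τ ((ε : ℂ) * Complex.exp (Complex.I * θ)))

/-- The coefficients of the circle average `f_ε(x) = (2π)⁻¹ ∫₀^{2π} f(x + c_τ(ε e^{iθ})) dθ`. -/
def circleAverage (τ : ℍ) (ε : ℝ) (f : Freq → ℂ) : Freq → ℂ :=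
  fun k => f k * circleMultiplier τ ε k

/-! ### The Gaussian free field -/

/-- Non-zero frequencies. -/
abbrev FreqNZ : Type := {k : Freq // k ≠ 0}

/-- Sample space carrying i.i.d. real standard Gaussians `a_k`, `k ∈ ℤ² ∖ {0}`. -/
abbrev Sample : Type := FreqNZ → ℝ

/-- The law of an i.i.d. family of real standard Gaussians. -/
def gaussLaw : Measure Sample := Measure.infinitePi fun _ => ProbabilityTheory.gaussianReal 0 1

/-- `a_k`, with the convention `a_0 = 0`. -/
def ext (a : Sample) (k : Freq) : ℝ := if h : k ≠ 0 then a ⟨k, h⟩ else 0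

/-- Standard complex Gaussians `α_k = ((a_k + a_{-k}) + i (a_{-k} - a_k)) / 2`: they satisfy
`α_{-k} = conj α_k` and `E[α_k conj α_l] = δ_{kl}`. -/
def alphaGauss (a : Sample) (k : Freq) : ℂ :=
  ((ext a k + ext a (-k) : ℝ) + Complex.I * (ext a (-k) - ext a k : ℝ)) / 2

/-- The Fourier coefficients `c_k(τ) = Im τ / (2π |nτ - m|²)`, `k = (n, m) ≠ 0`, of the Green function
`G_τ` of `-(2π)⁻¹ Δ_τ`. -/
def greenCoeff (τ : ℍ) (k : Freq) : ℝ :=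
  τ.im / (2 * Real.pi * ‖(k 0 : ℂ) * (τ : ℂ) - (k 1 : ℂ)‖ ^ 2)

/-- The Gaussian free field `X_τ = ∑_{k ≠ 0} α_k c_k(τ)^{1/2} e^{2πi k·x}`: the centred real Gaussian
field with covariance `G_τ`, of vanishing mean for `ĝ_τ`. -/
def gff (τ : ℍ) (a : Sample) : Freq → ℂ :=
  fun k => if k = 0 then 0 else alphaGauss a k * (Real.sqrt (greenCoeff τ k) : ℂ)

/-! ### The metric `g = e^φ ĝ_τ` -/

/-- The mean `m_g(f) = λ_g(𝕋)⁻¹ ∫ f dλ_g` of a distribution `f`, where `dλ_g = e^φ dλ_τ`. -/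
def meanMetric (τ : ℍ) (φ : H1) (f : Freq → ℂ) : ℝ :=
  (τ.im * pairing f (fourierCoeffReal fun x => Real.exp (φ.fn x))) /
    ∫ x, Real.exp (φ.fn x) ∂(volTau τ)

/-- The free field `X_g = X_τ - m_g(X_τ)` with vanishing mean for `g = e^φ ĝ_τ`. -/
def gffMetric (τ : ℍ) (φ : H1) (a : Sample) : Freq → ℂ :=
  gff τ a - constCoeff (meanMetric τ φ (gff τ a))

/-- The Fourier coefficients of the distribution
`Δ_τ φ = (Im τ)⁻² (|τ|² ∂₁₁ - 2 Re τ ∂₁₂ + ∂₂₂) φ`. -/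
def laplaceCoeff (τ : ℍ) (φ : H1) (k : Freq) : ℂ :=
  ((-(4 * Real.pi ^ 2) * (τ.im ^ 2)⁻¹ * (‖(τ : ℂ)‖ ^ 2 * (k 0 : ℝ) ^ 2 -
    2 * τ.re * (k 0 : ℝ) * (k 1 : ℝ) + (k 1 : ℝ) ^ 2) : ℝ) : ℂ) * φ.coeff k

/-- The curvature integral `∫ R_g f dλ_g` for `g = e^φ ĝ_τ`, where `R_g = -e^{-φ} Δ_τ φ`, that is
`R_g dλ_g = -Δ_τ φ dλ_τ`. -/
def curvatureIntegral (τ : ℍ) (φ : H1) (f : Freq → ℂ) : ℝ :=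
  τ.im * pairing f (fun k => -laplaceCoeff τ φ k)

/-- The free field partition function
`Z(e^φ ĝ_τ) = exp((96π)⁻¹ ∫ |∂^τ φ|²_τ dλ_τ) (Im τ)^{-1/2} |η(τ)|⁻²`. -/
def freePartition (τ : ℍ) (φ : H1) : ℝ :=
  Real.exp (dirichletEnergy τ φ / (96 * Real.pi)) *
    (1 / (Real.sqrt τ.im * ‖ModularForm.eta (τ : ℂ)‖ ^ 2))

/-! ### The Liouville partition function -/

/-- `Q = 2/γ + γ/2`. -/
def bigQ (γ : ℝ) : ℝ := 2 / γ + γ / 2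

/-- The Liouville field `c + X_g - (Q/2) ln(Im τ) + (Q/2) φ` in the metric `g = e^φ ĝ_τ`. -/
def liouvilleField (γ : ℝ) (τ : ℍ) (φ : H1) (c : ℝ) (a : Sample) : Freq → ℂ :=
  constCoeff c + gffMetric τ φ a - constCoeff (bigQ γ / 2 * Real.log τ.im) +
    (fun k => ((bigQ γ / 2 : ℝ) : ℂ) * φ.coeff k)

/-- Its regularisation at scale `ε` by averages over circles of the metric `ĝ_τ`. -/
def liouvilleFieldReg (γ : ℝ) (τ : ℍ) (φ : H1) (ε c : ℝ) (a : Sample) : Freq → ℂ :=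
  circleAverage τ ε (liouvilleField γ τ φ c a)

/-- The integrand, in the zero mode `c` and the sample `a`, of the regularised partition function. -/
def liouvilleIntegrand (γ μ : ℝ) {n : ℕ} (z : Fin n → Torus) (α : Fin n → ℝ) (τ : ℍ) (φ : H1)
    (F : HNegOne → ℝ) (ε : ℝ) (p : ℝ × Sample) : ℝ :=
  F (toHNegOne (liouvilleFieldReg γ τ φ ε p.1 p.2)) *
    (∏ i, ε ^ (α i ^ 2 / 2) *
      Real.exp (α i * evalAt (liouvilleFieldReg γ τ φ ε p.1 p.2) (z i))) *
    Real.exp (-(bigQ γ / (4 * Real.pi)) *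
        curvatureIntegral τ φ (constCoeff p.1 + gffMetric τ φ p.2) -
      μ * ε ^ (γ ^ 2 / 2) *
        ∫ x, Real.exp (γ * evalAt (liouvilleFieldReg γ τ φ ε p.1 p.2) x) ∂(volTau τ))

/-- The measure `dc ⊗ ℙ`. -/
def zeroModeGauss : Measure (ℝ × Sample) := (volume : Measure ℝ).prod gaussLaw

/-- The regularised partition function `Π(g, F, ε)` for `g = e^φ ĝ_τ`. -/
def partitionReg (γ μ : ℝ) {n : ℕ} (z : Fin n → Torus) (α : Fin n → ℝ) (τ : ℍ) (φ : H1)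
    (F : HNegOne → ℝ) (ε : ℝ) : ℝ :=
  freePartition τ φ * ∫ p, liouvilleIntegrand γ μ z α τ φ F ε p ∂zeroModeGauss

/-- The limit `Π(g, F) = lim_{ε → 0} Π(g, F, ε)` exists, is non-trivial (in `]0, ∞[`) and equals `L`.
The integral defining `Π(g, F, ε)` has to converge for all small `ε`. -/
def IsNontrivialPartition (γ μ : ℝ) {n : ℕ} (z : Fin n → Torus) (α : Fin n → ℝ) (τ : ℍ) (φ : H1)
    (F : HNegOne → ℝ) (L : ℝ) : Prop :=
  0 < L ∧
  (∀ᶠ ε in 𝓝[>] (0 : ℝ), Integrable (liouvilleIntegrand γ μ z α τ φ F ε) zeroModeGauss) ∧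
  Tendsto (partitionReg γ μ z α τ φ F) (𝓝[>] 0) (𝓝 L)

end LQFT

end

/-! The anomaly comes from three changes of variables at fixed `ε`; letting `ε → 0` then only
multiplies a limit by a constant.

Lebesgue measure `dc` is translation invariant, so shifting `c` by the mean of `X_τ` with respect to
`g` replaces `c + X_g` by `c + X_τ`. By Gauss–Bonnet the curvature term does not see this constant.
What remains is a weight depending only on the field `c + X_τ - (Q/2) ln(Im τ) + (Q/2) φ`, times
`exp(-(Q/4π) ∫ R_g X_τ dλ_g)`.

Since `R_g dλ_g = -Δ_τ φ dλ_τ` and `X_τ` has covariance the Green function of `-(2π)⁻¹ Δ_τ`, the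
exponent is the Gaussian linear functional attached to `-(Q/2) φ` in the Cameron–Martin space. The
exponential is therefore a Girsanov density times `exp(σ²/2)`, with `σ²` the variance of the
exponent. Under this density `X_τ` is shifted by `-(Q/2)(φ - φ_0)`, which cancels the non-constant
part of `(Q/2) φ`; the constant `(Q/2) φ_0` is absorbed by a last translation of `c`.

By Parseval `σ²/2 = Q² E / (16π) = 6 Q² E / (96π)`, where `E` is the Dirichlet energy
(`hasSum_dirichletEnergy`, `hasSum_fieldShift_sq`). The free partition function contributes `E /
(96π)`, whence `1 + 6Q²`. The other main ingredients are `stdGaussian_map_add` (Cameron–Martin),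
`curvatureIntegral_gff` and `flatField_shift`; `weyl_anomaly_reg` combines them. -/

noncomputable section

namespace LQFT

/-! ### Girsanov densities and the Cameron–Martin theorem for i.i.d. Gaussians. -/

section CameronMartin

open ProbabilityTheory Measure
open scoped ENNReal NNReal

/-- The limit of a sequence of measurable real functions is measurable, with the junk value of
`limUnder` where there is no limit. -/
lemma measurable_limUnder_nat {Ω : Type*} [MeasurableSpace Ω] {f : ℕ → Ω → ℝ}
    (hf : ∀ n, Measurable (f n)) : Measurable fun a => limUnder atTop fun n => f n a := by
  classical
  set C : Set Ω := {a | ∃ l, Tendsto (fun n => f n a) atTop (𝓝 l)} with hC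
  have hCm : MeasurableSet C := measurableSet_exists_tendsto hf
  -- Where no limit exists, `limUnder` chooses from the predicate that is false everywhere, so its
  -- default value is the same `j` for every such point.
  let j : ℝ := Classical.epsilon fun _ : ℝ => False
  refine measurable_of_tendsto_metrizable
    (f := fun n a => if a ∈ C then f n a else j)
    (fun n => Measurable.ite hCm (hf n) measurable_const) ?_
  rw [tendsto_pi_nhds]
  intro a
  by_cases ha : a ∈ C
  · simp only [ha, if_true]
    exact tendsto_nhds_limUnder ha
  · have hj : limUnder atTop (fun n => f n a) = j := by
      have h : (fun l : ℝ => map (fun n => f n a) atTop ≤ 𝓝 l) = fun _ => False := by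
        funext l
        exact propext ⟨fun h => ha ⟨l, h⟩, False.elim⟩
      simp only [limUnder, lim, j, h]
    simp only [ha, if_false, hj]
    exact tendsto_const_nhds

lemma gaussianReal_eq_withDensity (m : ℝ) :
    gaussianReal m 1 = (gaussianReal 0 1).withDensity
      fun x => ENNReal.ofReal (Real.exp (m * x - m ^ 2 / 2)) := by
  rw [gaussianReal_of_var_ne_zero _ one_ne_zero, gaussianReal_of_var_ne_zero _ one_ne_zero,
    ← withDensity_mul _ (measurable_gaussianPDF 0 1) (by fun_prop)]
  congr 1
  funext x
  simp only [Pi.mul_apply, gaussianPDF, gaussianPDFReal]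
  rw [← ENNReal.ofReal_mul (by positivity), mul_assoc _ (Real.exp _), ← Real.exp_add]
  congr 3
  simp
  ring

/-- The law of an independent family of standard Gaussians. -/
abbrev stdGaussian (ι : Type*) : Measure (ι → ℝ) := infinitePi fun _ => gaussianReal 0 1

/-- The Girsanov density along `h`, restricted to the finitely many coordinates in `s`. -/
def shiftDensity {ι : Type*} (h : ι → ℝ) (s : Finset ι) (a : ι → ℝ) : ℝ :=
  Real.exp (∑ k ∈ s, h k * a k - (∑ k ∈ s, h k ^ 2) / 2)

variable {ι : Type*} {h : ι → ℝ}

lemma measurable_shiftDensity (s : Finset ι) : Measurable (shiftDensity h s) := by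
  unfold shiftDensity; fun_prop

lemma lintegral_prod_stdGaussian (s : Finset ι) {f : ι → ℝ → ℝ≥0∞} (hf : ∀ k, Measurable (f k)) :
    ∫⁻ a, ∏ k ∈ s, f k (a k) ∂(stdGaussian ι) = ∏ k ∈ s, ∫⁻ x, f k x ∂(gaussianReal 0 1) := by
  have hi : iIndepFun (fun k (a : ι → ℝ) => f k (a k)) (stdGaussian ι) :=
    iIndepFun_infinitePi hf
  rw [lintegral_prod_eq_prod_lintegral_of_indepFun s _ hi (by fun_prop)]
  refine Finset.prod_congr rfl fun k _ => ?_
  rw [← lintegral_map (hf k) (measurable_pi_apply k), infinitePi_map_eval]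

lemma shiftDensity_pos (s : Finset ι) (a : ι → ℝ) : 0 < shiftDensity h s a := Real.exp_pos _

lemma ofReal_shiftDensity (s : Finset ι) (a : ι → ℝ) : ENNReal.ofReal (shiftDensity h s a) =
    ∏ k ∈ s, ENNReal.ofReal (Real.exp (h k * a k - h k ^ 2 / 2)) := by
  rw [shiftDensity, Finset.sum_div, ← Finset.sum_sub_distrib, Real.exp_sum,
    ENNReal.ofReal_prod_of_nonneg fun _ _ => (Real.exp_pos _).le]

/-- The density is a product over coordinates, so independence factorises the integral. Coordinates
of `s` outside `T` are unconstrained and contribute total mass one, which makes the value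
independent of `s ⊇ T`. -/
lemma setLIntegral_shiftDensity {s T : Finset ι} (hT : T ⊆ s) {t : ι → Set ℝ}
    (ht : ∀ k, MeasurableSet (t k)) :
    ∫⁻ a in (T : Set ι).pi t, ENNReal.ofReal (shiftDensity h s a) ∂(stdGaussian ι) =
      ∏ k ∈ T, gaussianReal (h k) 1 (t k) := by
  classical
  rw [← lintegral_indicator (MeasurableSet.pi T.countable_toSet fun k _ => ht k)]
  let u : ι → Set ℝ := fun k => if k ∈ T then t k else Set.univ
  have hu : ∀ k, MeasurableSet (u k) := fun k => by
    by_cases hk : k ∈ T <;> simp [u, hk, ht k]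
  have key : ∀ a : ι → ℝ, ((T : Set ι).pi t).indicator
      (fun a => ENNReal.ofReal (shiftDensity h s a)) a =
      ∏ k ∈ s, (u k).indicator
        (fun x => ENNReal.ofReal (Real.exp (h k * x - h k ^ 2 / 2))) (a k) := by
    intro a
    by_cases ha : a ∈ (T : Set ι).pi t
    · rw [Set.indicator_of_mem ha, ofReal_shiftDensity]
      refine Finset.prod_congr rfl fun k _ => ?_
      rw [Set.indicator_of_mem]
      by_cases hk : k ∈ T
      · simpa [u, hk] using ha k hk
      · simp [u, hk]
    · rw [Set.indicator_of_notMem ha]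
      simp only [Set.mem_pi, not_forall] at ha
      obtain ⟨k, hk, hak⟩ := ha
      have hak' : a k ∉ u k := by simpa only [u, if_pos (Finset.mem_coe.1 hk)] using hak
      exact (Finset.prod_eq_zero (hT hk) (Set.indicator_of_notMem hak' _)).symm
  simp_rw [key]
  rw [lintegral_prod_stdGaussian s
    (f := fun k => (u k).indicator fun x => ENNReal.ofReal (Real.exp (h k * x - h k ^ 2 / 2)))
    fun k => Measurable.indicator (by fun_prop) (hu k)]
  have h1 : ∀ k, ∫⁻ x, (u k).indicator
      (fun x => ENNReal.ofReal (Real.exp (h k * x - h k ^ 2 / 2))) x ∂(gaussianReal 0 1) =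
      gaussianReal (h k) 1 (u k) := fun k => by
    rw [lintegral_indicator (hu k), gaussianReal_eq_withDensity (h k), withDensity_apply _ (hu k)]
  simp_rw [h1]
  rw [← Finset.prod_subset hT fun k _ hk => by simp [u, hk]]
  exact Finset.prod_congr rfl fun k hk => by simp [u, hk]

lemma lintegral_shiftDensity (s : Finset ι) :
    ∫⁻ a, ENNReal.ofReal (shiftDensity h s a) ∂(stdGaussian ι) = 1 := by
  simpa using setLIntegral_shiftDensity (h := h) (Finset.empty_subset s) (t := fun _ => Set.univ)
    fun _ => MeasurableSet.univ

lemma integrable_shiftDensity (s : Finset ι) : Integrable (shiftDensity h s) (stdGaussian ι) := by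
  refine ⟨(measurable_shiftDensity s).aestronglyMeasurable, ?_⟩
  rw [hasFiniteIntegral_iff_ofReal (ae_of_all _ fun a => (shiftDensity_pos s a).le),
    lintegral_shiftDensity]
  exact ENNReal.one_lt_top

/-- Squaring doubles the shift, and renormalising costs `exp(∑ h²)`. As the doubled density again
has mass one, this gives the second moment. -/
lemma shiftDensity_sq (s : Finset ι) (a : ι → ℝ) :
    shiftDensity h s a ^ 2 =
      Real.exp (∑ k ∈ s, h k ^ 2) * shiftDensity (fun k => 2 * h k) s a := by
  simp only [shiftDensity, ← Real.exp_nat_mul, ← Real.exp_add, mul_pow, mul_assoc,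
    ← Finset.mul_sum]
  congr 1
  push_cast
  ring

lemma lintegral_shiftDensity_sq (s : Finset ι) :
    ∫⁻ a, ENNReal.ofReal (shiftDensity h s a ^ 2) ∂(stdGaussian ι) =
      ENNReal.ofReal (Real.exp (∑ k ∈ s, h k ^ 2)) := by
  simp_rw [shiftDensity_sq, ENNReal.ofReal_mul (Real.exp_pos _).le]
  rw [lintegral_const_mul _ (measurable_shiftDensity s).ennreal_ofReal, lintegral_shiftDensity,
    mul_one]

/-- The Girsanov densities are uniformly integrable, being bounded in `L²`. -/
lemma unifIntegrable_shiftDensity (hh : Summable fun k => h k ^ 2) (s : ℕ → Finset ι) :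
    UnifIntegrable (fun N => shiftDensity h (s N)) 1 (stdGaussian ι) := by
  refine unifIntegrable_of le_rfl ENNReal.one_ne_top
    (fun N => (measurable_shiftDensity _).aestronglyMeasurable) fun ε hε => ?_
  set B := Real.exp (∑' k, h k ^ 2) with hB
  have hBpos : 0 < B := Real.exp_pos _
  -- Above the threshold `B / ε` a density `D` satisfies `D ≤ (ε / B) D²`, while `∫ D² ≤ B`.
  refine ⟨Real.toNNReal (B / ε), fun N => ?_⟩
  have hpos := shiftDensity_pos (h := h) (s N)
  rw [eLpNorm_one_eq_lintegral_enorm]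
  calc _ ≤ ∫⁻ a, ENNReal.ofReal (ε / B) * ENNReal.ofReal (shiftDensity h (s N) a ^ 2)
        ∂(stdGaussian ι) := by
        refine lintegral_mono fun a => ?_
        by_cases ha : a ∈ {x | Real.toNNReal (B / ε) ≤ ‖shiftDensity h (s N) x‖₊}
        · rw [Set.indicator_of_mem ha, Real.enorm_eq_ofReal (hpos a).le,
            ← ENNReal.ofReal_mul (by positivity)]
          refine ENNReal.ofReal_le_ofReal ?_
          have h1 : B / ε ≤ shiftDensity h (s N) a := by
            have := (Real.toNNReal_le_iff_le_coe).1 ha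
            simpa [abs_of_pos (hpos a)] using this
          rw [div_le_iff₀ hε] at h1
          rw [div_mul_eq_mul_div, le_div_iff₀ hBpos]
          nlinarith [hpos a]
        · rw [Set.indicator_of_notMem ha]; simp
    _ = ENNReal.ofReal (ε / B * Real.exp (∑ k ∈ s N, h k ^ 2)) := by
        rw [lintegral_const_mul _ ((measurable_shiftDensity _).pow_const 2).ennreal_ofReal,
          lintegral_shiftDensity_sq, ← ENNReal.ofReal_mul (by positivity)]
    _ ≤ ENNReal.ofReal ε := by
        refine ENNReal.ofReal_le_ofReal ?_
        have : Real.exp (∑ k ∈ s N, h k ^ 2) ≤ B :=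
          Real.exp_le_exp.2 (hh.sum_le_tsum _ fun k _ => sq_nonneg _)
        rw [div_mul_eq_mul_div, div_le_iff₀ hBpos]
        exact mul_le_mul_of_nonneg_left this hε.le

/-! ### Almost sure convergence of Gaussian series. -/

lemma memLp_eval_stdGaussian (k : ι) : MemLp (fun a : ι → ℝ => a k) 2 (stdGaussian ι) :=
  (memLp_id_gaussianReal' 2 (by norm_num)).comp_measurePreserving
    (measurePreserving_eval_infinitePi (fun _ : ι => gaussianReal 0 1) k)

lemma integral_eval_stdGaussian (k : ι) : ∫ a : ι → ℝ, a k ∂(stdGaussian ι) = 0 := by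
  have h1 := integral_map (μ := stdGaussian ι) (measurable_pi_apply k).aemeasurable
    (f := fun x : ℝ => x) measurable_id.aestronglyMeasurable
  rw [infinitePi_map_eval] at h1
  rw [← h1, integral_id_gaussianReal]

lemma integrable_sum_stdGaussian (h : ι → ℝ) (s : Finset ι) :
    Integrable (fun a => ∑ k ∈ s, h k * a k) (stdGaussian ι) :=
  integrable_finsetSum _ fun k _ => ((memLp_eval_stdGaussian k).integrable (by norm_num)).const_mul _

lemma integral_sum_stdGaussian (h : ι → ℝ) (s : Finset ι) :
    ∫ a, ∑ k ∈ s, h k * a k ∂(stdGaussian ι) = 0 := by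
  rw [integral_finsetSum _ fun k _ =>
    ((memLp_eval_stdGaussian k).integrable (by norm_num)).const_mul _]
  simp [integral_const_mul, integral_eval_stdGaussian]

/-- Partial sums of independent Gaussians form a martingale. -/
lemma martingale_sum_stdGaussian (h : ι → ℝ) {s : ℕ → Finset ι} (hs : Monotone s) :
    ∃ ℱ : Filtration ℕ (inferInstance : MeasurableSpace (ι → ℝ)),
      Martingale (fun N a => ∑ k ∈ s N, h k * a k) ℱ (stdGaussian ι) := by
  classical
  let ℱ : Filtration ℕ (inferInstance : MeasurableSpace (ι → ℝ)) :=
    { seq := fun N => MeasurableSpace.comap (s N).restrict inferInstance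
      mono' := fun M N hMN => (Filtration.piFinset (X := fun _ : ι => ℝ)).mono (hs hMN)
      le' := fun N => (Filtration.piFinset (X := fun _ : ι => ℝ)).le (s N) }
  have hmeas : ∀ T : Finset ι, Measurable[MeasurableSpace.comap T.restrict inferInstance]
      fun a : ι → ℝ => ∑ k ∈ T, h k * a k := by
    intro T
    have : (fun a : ι → ℝ => ∑ k ∈ T, h k * a k) =
        (fun b : T → ℝ => ∑ k : T, h k * b k) ∘ T.restrict := by
      funext a
      exact (Finset.sum_coe_sort T fun k => h k * a k).symm
    rw [this]
    exact Measurable.comp (by fun_prop) (comap_measurable _)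
  refine ⟨ℱ, martingale_of_condExp_sub_eq_zero_nat
    (fun N => (hmeas (s N)).stronglyMeasurable) (fun N => integrable_sum_stdGaussian h _)
    fun N => ?_⟩
  have hsub : ((fun a : ι → ℝ => ∑ k ∈ s (N + 1), h k * a k) -
      fun a : ι → ℝ => ∑ k ∈ s N, h k * a k) =
      fun a : ι → ℝ => ∑ k ∈ s (N + 1) \ s N, h k * a k := by
    funext a
    simp only [Pi.sub_apply]
    rw [← Finset.sum_sdiff (hs N.le_succ)]
    simp
  rw [hsub]
  -- The increment involves only coordinates disjoint from those generating `ℱ N`, so its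
  -- conditional expectation is its mean, zero.
  have hind : Indep (MeasurableSpace.comap (s (N + 1) \ s N).restrict inferInstance) (ℱ N)
      (stdGaussian ι) :=
    iIndepFun.indepFun_finset (s (N + 1) \ s N) (s N) Finset.sdiff_disjoint
      (iIndepFun_infinitePi (P := fun _ : ι => gaussianReal 0 1)
        (X := fun _ x => x) fun _ => measurable_id) fun k => measurable_pi_apply k
  refine (condExp_indep_eq (Finset.measurable_restrict _).comap_le (ℱ.le N)
    (hmeas _).stronglyMeasurable hind).trans (ae_of_all _ fun a => ?_)
  exact integral_sum_stdGaussian h _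

lemma integral_sq_sum_stdGaussian (h : ι → ℝ) (s : Finset ι) :
    ∫ a, (∑ k ∈ s, h k * a k) ^ 2 ∂(stdGaussian ι) = ∑ k ∈ s, h k ^ 2 := by
  have hX : ∀ k ∈ s, MemLp (fun a : ι → ℝ => h k * a k) 2 (stdGaussian ι) :=
    fun k _ => (memLp_eval_stdGaussian k).const_mul _
  have hvar : ∀ k, Var[fun a : ι → ℝ => h k * a k; stdGaussian ι] = h k ^ 2 := by
    intro k
    have h1 : Var[fun a : ι → ℝ => a k; stdGaussian ι] = 1 := by
      have h2 := variance_map (X := fun x : ℝ => x) (Y := fun a : ι → ℝ => a k)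
        (μ := stdGaussian ι) measurable_id.aemeasurable (measurable_pi_apply k).aemeasurable
      rw [infinitePi_map_eval, variance_fun_id_gaussianReal] at h2
      simpa [Function.comp_def] using h2.symm
    rw [variance_const_mul, h1, mul_one]
  have hind : Set.Pairwise (s : Set ι) fun i j =>
      IndepFun (fun a : ι → ℝ => h i * a i) (fun a : ι → ℝ => h j * a j) (stdGaussian ι) :=
    fun i _ j _ hij => (iIndepFun_infinitePi (P := fun _ : ι => gaussianReal 0 1)
      (X := fun k x => h k * x) fun k => by fun_prop).indepFun hij
  have h3 := IndepFun.variance_sum hX hind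
  simp_rw [hvar] at h3
  rw [← h3, variance_eq_sub (memLp_finsetSum' _ hX)]
  have h4 : (stdGaussian ι)[∑ k ∈ s, fun a : ι → ℝ => h k * a k] = 0 := by
    rw [← integral_sum_stdGaussian h s]
    exact integral_congr_ae (ae_of_all _ fun a => by simp)
  rw [h4]
  simp

/-- A series of independent centred Gaussians with summable variances converges almost surely. -/
lemma ae_exists_tendsto_sum_stdGaussian (hh : Summable fun k => h k ^ 2) {s : ℕ → Finset ι}
    (hs : Monotone s) :
    ∀ᵐ a ∂(stdGaussian ι), ∃ c, Tendsto (fun N => ∑ k ∈ s N, h k * a k) atTop (𝓝 c) := by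
  obtain ⟨ℱ, hℱ⟩ := martingale_sum_stdGaussian h hs
  -- The `L¹` bound required by Doob's theorem follows from `|x| ≤ 1 + x²` and the variances.
  refine hℱ.submartingale.exists_ae_tendsto_of_bdd (R := Real.toNNReal (1 + ∑' k, h k ^ 2))
    fun N => ?_
  have hi := integrable_sum_stdGaussian h (s N)
  have hi2 : Integrable (fun a => (∑ k ∈ s N, h k * a k) ^ 2) (stdGaussian ι) :=
    (memLp_finsetSum (s N) fun k _ => (memLp_eval_stdGaussian k).const_mul (h k)).integrable_sq
  rw [eLpNorm_one_eq_lintegral_enorm, ← ofReal_integral_norm_eq_lintegral_enorm hi]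
  refine ENNReal.ofReal_le_ofReal ?_
  calc ∫ a, ‖∑ k ∈ s N, h k * a k‖ ∂(stdGaussian ι)
      ≤ ∫ a, (1 + (∑ k ∈ s N, h k * a k) ^ 2) ∂(stdGaussian ι) := by
        refine integral_mono hi.norm ((integrable_const _).add hi2) fun a => ?_
        simp only [Real.norm_eq_abs]
        nlinarith [sq_nonneg (|∑ k ∈ s N, h k * a k| - 1), sq_abs (∑ k ∈ s N, h k * a k),
          abs_nonneg (∑ k ∈ s N, h k * a k)]
    _ = 1 + ∑ k ∈ s N, h k ^ 2 := by
        rw [integral_add (integrable_const _) hi2, integral_sq_sum_stdGaussian]; simp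
    _ ≤ _ := by gcongr; exact hh.sum_le_tsum _ fun k _ => sq_nonneg _

/-- **Cameron–Martin theorem** for an independent family of standard Gaussians. -/
theorem stdGaussian_map_add (hh : Summable fun k => h k ^ 2) {s : ℕ → Finset ι}
    (hs : Monotone s) (hs' : ∀ k, ∃ N, k ∈ s N) :
    (stdGaussian ι).map (fun a => a + h) = (stdGaussian ι).withDensity fun a =>
      ENNReal.ofReal (Real.exp ((limUnder atTop fun N => ∑ k ∈ s N, h k * a k) -
        (∑' k, h k ^ 2) / 2)) := by
  classical
  set D : (ι → ℝ) → ℝ := fun a => Real.exp ((limUnder atTop fun N => ∑ k ∈ s N, h k * a k) -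
        (∑' k, h k ^ 2) / 2) with hD
  have hDm : Measurable D :=
    ((measurable_limUnder_nat fun N => by fun_prop).sub_const _).exp
  have htop : Tendsto s atTop atTop := tendsto_atTop_finset_of_monotone hs hs'
  have hlim : ∀ᵐ a ∂(stdGaussian ι),
      Tendsto (fun N => shiftDensity h (s N) a) atTop (𝓝 (D a)) := by
    filter_upwards [ae_exists_tendsto_sum_stdGaussian hh hs] with a ha
    refine (Real.continuous_exp.tendsto _).comp ((tendsto_nhds_limUnder ha).sub ?_)
    exact (hh.hasSum.comp htop).div_const 2
  have hDpos : ∀ a, 0 ≤ D a := fun a => (Real.exp_pos _).le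
  -- Fatou's lemma: the approximating densities all have mass one.
  have hDi : Integrable D (stdGaussian ι) := by
    refine ⟨hDm.aestronglyMeasurable, ?_⟩
    rw [hasFiniteIntegral_iff_ofReal (ae_of_all _ hDpos)]
    refine lt_of_le_of_lt ?_ ENNReal.one_lt_top
    calc ∫⁻ a, ENNReal.ofReal (D a) ∂(stdGaussian ι)
        = ∫⁻ a, liminf (fun N => ENNReal.ofReal (shiftDensity h (s N) a)) atTop
            ∂(stdGaussian ι) := by
          refine lintegral_congr_ae ?_
          filter_upwards [hlim] with a ha
          exact ((ENNReal.continuous_ofReal.tendsto _).comp ha).liminf_eq.symm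
      _ ≤ liminf (fun N => ∫⁻ a, ENNReal.ofReal (shiftDensity h (s N) a) ∂(stdGaussian ι)) atTop :=
          lintegral_liminf_le fun N => (measurable_shiftDensity _).ennreal_ofReal
      _ = 1 := by simp [lintegral_shiftDensity]
  -- Vitali's theorem: uniform integrability upgrades almost sure convergence to `L¹`, so no mass is
  -- lost in the limit.
  have hL1 := tendsto_Lp_finite_of_tendsto_ae le_rfl ENNReal.one_ne_top
    (fun N => (measurable_shiftDensity (h := h) (s N)).aestronglyMeasurable)
    (memLp_one_iff_integrable.2 hDi) (unifIntegrable_shiftDensity hh s) hlim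
  have hR : (stdGaussian ι).withDensity (fun a => ENNReal.ofReal (D a)) =
      infinitePi fun k => gaussianReal (h k) 1 := by
    refine eq_infinitePi _ fun T t ht => ?_
    have hA : MeasurableSet ((T : Set ι).pi t) := MeasurableSet.pi T.countable_toSet fun k _ => ht k
    have h1 := tendsto_setIntegral_of_L1' D hDm.aestronglyMeasurable
      (Eventually.of_forall fun N => integrable_shiftDensity (s N)) hL1 ((T : Set ι).pi t)
    -- On a cylinder over `T` the integrals are constant as soon as `T ⊆ s N`.
    have h2 : ∀ᶠ N in atTop, ∫ a in (T : Set ι).pi t, shiftDensity h (s N) a ∂(stdGaussian ι) =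
        (∏ k ∈ T, gaussianReal (h k) 1 (t k)).toReal := by
      filter_upwards [htop.eventually (eventually_ge_atTop T)] with N hN
      rw [integral_eq_lintegral_of_nonneg_ae (ae_of_all _ fun a => (shiftDensity_pos _ a).le)
        (measurable_shiftDensity _).aestronglyMeasurable, setLIntegral_shiftDensity hN ht]
    have h3 := tendsto_nhds_unique h1 (tendsto_const_nhds.congr' (h2.mono fun N hN => hN.symm))
    rw [withDensity_apply _ hA, ← ofReal_integral_eq_lintegral_ofReal hDi.integrableOn
      (ae_of_all _ hDpos), h3, ENNReal.ofReal_toReal]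
    exact ENNReal.prod_ne_top fun k _ => measure_ne_top _ _
  rw [hR]
  have h4 := infinitePi_map_pi (fun _ : ι => gaussianReal 0 1) (f := fun k x => x + h k)
    fun k => by fun_prop
  refine Eq.trans ?_ (h4.trans ?_)
  · rfl
  · congr 1
    funext k
    rw [gaussianReal_map_add_const, zero_add]

end CameronMartin

/-! ### Fourier coefficients and the Dirichlet energy -/

lemma H1.coeff_neg (φ : H1) (k : Freq) : φ.coeff (-k) = conj (φ.coeff k) := by
  unfold H1.coeff fourierCoeffReal UnitAddTorus.mFourierCoeff
  rw [← integral_conj]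
  refine integral_congr_ae (ae_of_all _ fun x => ?_)
  simp [UnitAddTorus.mFourier_neg]

lemma H1.coeff_zero_im (φ : H1) : ((φ.coeff 0).re : ℂ) = φ.coeff 0 := by
  rw [← Complex.conj_eq_iff_re, ← H1.coeff_neg, neg_zero]

lemma H1.coeff_of_zero (k : Freq) : H1.coeff 0 k = 0 := fourierCoeffReal_zero k

lemma freq_ne_zero (τ : ℍ) {k : Freq} (hk : k ≠ 0) : (k 0 : ℂ) * (τ : ℂ) - (k 1 : ℂ) ≠ 0 := by
  intro h
  have him := congrArg Complex.im h
  have hre := congrArg Complex.re h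
  simp at him hre
  have h0 : k 0 = 0 := him.resolve_right τ.im_ne_zero
  have h1 : k 1 = 0 := by simpa [h0] using hre
  exact hk (funext fun i => by fin_cases i <;> simp [h0, h1])

lemma greenCoeff_pos (τ : ℍ) {k : Freq} (hk : k ≠ 0) : 0 < greenCoeff τ k := by
  have := norm_pos_iff.2 (freq_ne_zero τ hk)
  have := τ.im_pos
  unfold greenCoeff
  positivity

lemma greenCoeff_neg (τ : ℍ) (k : Freq) : greenCoeff τ (-k) = greenCoeff τ k := by
  unfold greenCoeff
  rw [← norm_neg]
  congr 4
  simp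
  ring

/-- `φ_k / √c_k`, the coordinates of `φ` in the Cameron–Martin space of the free field. -/
def cmCoeff (τ : ℍ) (φ : H1) (k : Freq) : ℂ :=
  φ.coeff k / (Real.sqrt (greenCoeff τ k) : ℂ)

/-- Division by zero sets `c_0 = 0`, hence also the zeroth Cameron–Martin coordinate, so sums over
all frequencies effectively run over the non-zero ones. -/
lemma greenCoeff_zero (τ : ℍ) : greenCoeff τ 0 = 0 := by simp [greenCoeff]

lemma cmCoeff_zero (τ : ℍ) (φ : H1) : cmCoeff τ φ 0 = 0 := by simp [cmCoeff, greenCoeff_zero]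

lemma cmCoeff_neg (τ : ℍ) (φ : H1) (k : Freq) : cmCoeff τ φ (-k) = conj (cmCoeff τ φ k) := by
  simp [cmCoeff, H1.coeff_neg, greenCoeff_neg]

lemma sq_norm_cmCoeff (τ : ℍ) (φ : H1) (k : Freq) :
    ‖cmCoeff τ φ k‖ ^ 2 =
      2 * Real.pi / τ.im * ‖(k 0 : ℂ) * (τ : ℂ) - (k 1 : ℂ)‖ ^ 2 * ‖φ.coeff k‖ ^ 2 := by
  rcases eq_or_ne k 0 with rfl | hk
  · simp [cmCoeff_zero]
  have h1 := norm_pos_iff.2 (freq_ne_zero τ hk)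
  have h2 := τ.im_pos
  have h3 := (greenCoeff_pos τ hk).le
  rw [cmCoeff, norm_div, div_pow, Complex.norm_real, Real.norm_eq_abs, sq_abs, Real.sq_sqrt h3,
    greenCoeff]
  field_simp

/-- The gradient applies the inverse metric matrix to the covector `(p, q)`, so its length is the
dual norm of `(p, q)`. This yields the same modulus `|nτ - m|` as in the Green function. -/
lemma normSqTau_gradTau (τ : ℍ) (p q : ℝ) : normSqTau τ (gradTau τ p q) =
    (τ.im ^ 2)⁻¹ * ‖(τ : ℂ) * (p : ℂ) - (q : ℂ)‖ ^ 2 := by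
  have h := τ.im_ne_zero
  have hre : ((τ.im : ℂ) ^ 2).re = τ.im ^ 2 := by rw [← Complex.ofReal_pow, Complex.ofReal_re]
  have him : ((τ.im : ℂ) ^ 2).im = 0 := by rw [← Complex.ofReal_pow, Complex.ofReal_im]
  simp only [normSqTau, gradTau, ← Complex.normSq_eq_norm_sq, Complex.normSq_apply]
  simp [hre, him]
  field_simp
  ring

/-- **Parseval's identity** for the Dirichlet energy. -/
lemma hasSum_dirichletEnergy (τ : ℍ) (φ : H1) :
    HasSum (fun k : Freq => ‖cmCoeff τ φ k‖ ^ 2) (dirichletEnergy τ φ / (2 * Real.pi)) := by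
  have hτ := τ.im_pos
  have hp : ∀ j, MemLp (fun x => (φ.deriv j x : ℂ)) 2 lam := fun j => (Lp.memLp (φ.1.2 j)).ofReal
  -- The single complex function `τ ∂₁φ - ∂₂φ` carries the whole energy, so one application of
  -- Parseval suffices.
  have hu : MemLp (fun x => (τ : ℂ) * (φ.deriv 0 x : ℂ) - (φ.deriv 1 x : ℂ)) 2 lam :=
    ((hp 0).const_mul (τ : ℂ)).sub (hp 1)
  have hcoe := hu.coeFn_toLp
  have hcoeff : ∀ k, UnitAddTorus.mFourierCoeff (hu.toLp _) k =
      2 * Real.pi * Complex.I * ((k 0 : ℂ) * (τ : ℂ) - (k 1 : ℂ)) * φ.coeff k := by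
    intro k
    have hi : ∀ j, Integrable
        (fun x => UnitAddTorus.mFourier (-k) x • (φ.deriv j x : ℂ)) lam := by
      intro j
      refine ((hp j).integrable (by norm_num)).bdd_mul (c := 1)
        (UnitAddTorus.mFourier (-k)).continuous.aestronglyMeasurable (ae_of_all _ fun x => ?_)
      exact ((UnitAddTorus.mFourier (-k)).norm_coe_le_norm x).trans_eq UnitAddTorus.mFourier_norm
    have h0 : fourierCoeffReal (φ.deriv 0) k = 2 * Real.pi * Complex.I * (k 0 : ℂ) * φ.coeff k :=
      φ.2 0 k
    have h1 : fourierCoeffReal (φ.deriv 1) k = 2 * Real.pi * Complex.I * (k 1 : ℂ) * φ.coeff k :=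
      φ.2 1 k
    have h2 : UnitAddTorus.mFourierCoeff (hu.toLp _) k =
        (τ : ℂ) * fourierCoeffReal (φ.deriv 0) k - fourierCoeffReal (φ.deriv 1) k := by
      unfold fourierCoeffReal UnitAddTorus.mFourierCoeff
      refine Eq.trans ?_ ((integral_sub ((hi 0).const_mul (τ : ℂ)) (hi 1)).trans
        (congrArg (· - _) (integral_const_mul (τ : ℂ) _)))
      refine integral_congr_ae (μ := lam) ?_
      filter_upwards [hcoe] with x hx
      rw [hx]
      simp only [smul_eq_mul]
      ring
    rw [h2, h0, h1]
    ring
  have hP : HasSum (fun k => ‖UnitAddTorus.mFourierCoeff (hu.toLp _) k‖ ^ 2)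
      (∫ x, ‖hu.toLp _ x‖ ^ 2 ∂lam) := UnitAddTorus.hasSum_sq_mFourierCoeff (hu.toLp _)
  have hE : dirichletEnergy τ φ = τ.im⁻¹ * ∫ x, ‖hu.toLp _ x‖ ^ 2 ∂lam := by
    unfold dirichletEnergy volTau
    rw [integral_smul_measure, ENNReal.toReal_ofReal hτ.le, smul_eq_mul]
    simp_rw [normSqTau_gradTau]
    rw [integral_const_mul, ← mul_assoc]
    congr 1
    · field_simp
    · refine integral_congr_ae ?_
      filter_upwards [hcoe] with x hx
      rw [hx]
  have h3 := hP.mul_left (τ.im⁻¹ / (2 * Real.pi))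
  have h4 : dirichletEnergy τ φ / (2 * Real.pi) =
      τ.im⁻¹ / (2 * Real.pi) * ∫ x, ‖hu.toLp _ x‖ ^ 2 ∂lam := by rw [hE]; ring
  rw [h4]
  refine h3.congr_fun fun k => ?_
  rw [hcoeff, sq_norm_cmCoeff]
  simp only [norm_mul, Complex.norm_I, Complex.norm_real, Complex.norm_ofNat, mul_one, mul_pow,
    Real.norm_eq_abs, sq_abs]
  field_simp

lemma dirichletEnergy_zero (τ : ℍ) : dirichletEnergy τ 0 = 0 := by
  have h := hasSum_dirichletEnergy τ 0
  simp only [cmCoeff, H1.coeff_of_zero, zero_div, norm_zero, ne_eq, OfNat.ofNat_ne_zero,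
    not_false_eq_true, zero_pow] at h
  have := h.unique hasSum_zero
  simpa [Real.pi_ne_zero] using this

lemma freePartition_eq (τ : ℍ) (φ : H1) : freePartition τ φ =
    Real.exp (dirichletEnergy τ φ / (96 * Real.pi)) * freePartition τ 0 := by
  simp [freePartition, dirichletEnergy_zero]

/-! ### The Cameron–Martin shift -/

/-- The shift of the Gaussian coordinates that moves the field `X_τ` by `r (φ - φ_0)`. -/
def fieldShift (τ : ℍ) (φ : H1) (r : ℝ) (k : FreqNZ) : ℝ :=
  r * ((cmCoeff τ φ k).re - (cmCoeff τ φ k).im)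

lemma ext_add (a b : Sample) (k : Freq) : ext (a + b) k = ext a k + ext b k := by
  unfold ext; split_ifs <;> simp

lemma alphaGauss_add (a b : Sample) (k : Freq) :
    alphaGauss (a + b) k = alphaGauss a k + alphaGauss b k := by
  simp only [alphaGauss, ext_add]; push_cast; ring

lemma ext_fieldShift (τ : ℍ) (φ : H1) (r : ℝ) (k : Freq) : ext (fieldShift τ φ r) k =
    r * ((cmCoeff τ φ k).re - (cmCoeff τ φ k).im) := by
  by_cases hk : k = 0
  · simp [ext, hk, cmCoeff_zero]
  · simp [ext, hk, fieldShift]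

/-- For `w_{-k} = conj w_k`, the real coordinates `a_k = Re w_k - Im w_k` satisfy `a_k + a_{-k} = 2
Re w_k` and `a_{-k} - a_k = 2 Im w_k`. This explains the form of `fieldShift`. -/
lemma alphaGauss_fieldShift (τ : ℍ) (φ : H1) (r : ℝ) (k : Freq) :
    alphaGauss (fieldShift τ φ r) k = r * cmCoeff τ φ k := by
  simp only [alphaGauss, ext_fieldShift, cmCoeff_neg]
  apply Complex.ext
  · simp; ring
  · simp; ring

lemma gff_add_fieldShift (τ : ℍ) (φ : H1) (r : ℝ) (a : Sample) (k : Freq) :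
    gff τ (a + fieldShift τ φ r) k =
      gff τ a k + r * φ.coeff k - constCoeff (r * (φ.coeff 0).re) k := by
  by_cases hk : k = 0
  · subst hk
    simp [gff, constCoeff, H1.coeff_zero_im]
  · have h : (Real.sqrt (greenCoeff τ k) : ℂ) ≠ 0 :=
      Complex.ofReal_ne_zero.2 (Real.sqrt_pos.2 (greenCoeff_pos τ hk)).ne'
    simp only [gff, constCoeff, hk, if_false, alphaGauss_add, alphaGauss_fieldShift, cmCoeff]
    field_simp
    ring

/-- `(Re w - Im w)² = |w|² - 2 Re w Im w`, and the cross term is odd under `k ↦ -k`, so it sums to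
zero. -/
lemma hasSum_fieldShift_sq (τ : ℍ) (φ : H1) (r : ℝ) :
    HasSum (fun k => fieldShift τ φ r k ^ 2) (r ^ 2 * (dirichletEnergy τ φ / (2 * Real.pi))) := by
  have hE := hasSum_dirichletEnergy τ φ
  set w := cmCoeff τ φ with hw
  have hs : Summable fun k : Freq => (w k).re * (w k).im := by
    refine Summable.of_norm_bounded hE.summable fun k => ?_
    rw [norm_mul, sq]
    exact mul_le_mul (Complex.abs_re_le_norm _) (Complex.abs_im_le_norm _) (norm_nonneg _)
      (norm_nonneg _)
  have hodd : ∑' k : Freq, (w k).re * (w k).im = 0 := by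
    have h1 := (Equiv.neg Freq).tsum_eq fun k => (w k).re * (w k).im
    simp only [Equiv.neg_apply, hw, cmCoeff_neg, Complex.conj_re, Complex.conj_im, mul_neg,
      tsum_neg] at h1
    linarith
  have h2 : HasSum (fun k : Freq => (r * ((w k).re - (w k).im)) ^ 2)
      (r ^ 2 * (dirichletEnergy τ φ / (2 * Real.pi))) := by
    have h3 := (hE.sub ((hs.hasSum.mul_left 2))).mul_left (r ^ 2)
    rw [hodd, mul_zero, sub_zero] at h3
    refine h3.congr_fun fun k => ?_
    rw [← Complex.normSq_eq_norm_sq, Complex.normSq_apply]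
    ring
  refine (hasSum_subtype_iff_of_support_subset (s := {k : Freq | k ≠ 0}) ?_).2 h2
  intro k hk h0
  apply hk
  have h0' : k = 0 := h0
  simp [h0', hw, cmCoeff_zero]

/-! ### The curvature term -/

lemma mem_box {N : ℕ} {k : Freq} : k ∈ box N ↔ ∀ i, |k i| ≤ N := by
  simp only [box, Finset.mem_Icc, Pi.le_def, abs_le]
  exact forall_and.symm

/-- The non-zero frequencies of a square. -/
def boxNZ (N : ℕ) : Finset FreqNZ := (box N).subtype fun k => k ≠ 0

lemma boxNZ_mono : Monotone boxNZ := by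
  intro M N hMN k hk
  simp only [boxNZ, Finset.mem_subtype, mem_box] at hk ⊢
  exact fun i => (hk i).trans (by exact_mod_cast hMN)

lemma exists_mem_boxNZ (k : FreqNZ) : ∃ N, k ∈ boxNZ N := by
  refine ⟨∑ i, (k.1 i).natAbs, ?_⟩
  simp only [boxNZ, Finset.mem_subtype, mem_box]
  intro i
  rw [Int.abs_eq_natAbs]
  exact_mod_cast Finset.single_le_sum (f := fun i => (k.1 i).natAbs) (fun _ _ => Nat.zero_le _)
    (Finset.mem_univ i)

lemma sum_box_neg (N : ℕ) (f : Freq → ℝ) : ∑ k ∈ box N, f (-k) = ∑ k ∈ box N, f k :=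
  Finset.sum_equiv (Equiv.neg Freq) (by simp [mem_box]) fun _ _ => rfl

/-- Each term on the left is the average of the right-hand terms at `k` and `-k`, and the square is
symmetric. -/
lemma sum_box_alphaGauss (a : Sample) (N : ℕ) {w : Freq → ℂ} (hw : ∀ k, w (-k) = conj (w k)) :
    ∑ k ∈ box N, (alphaGauss a k * conj (w k)).re =
      ∑ k ∈ box N, ext a k * ((w k).re - (w k).im) := by
  have h1 : ∀ k, (alphaGauss a k * conj (w k)).re =
      (ext a k * ((w k).re - (w k).im) + ext a (-k) * ((w (-k)).re - (w (-k)).im)) / 2 := by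
    intro k
    rw [hw]
    simp [alphaGauss]
    ring
  simp_rw [h1]
  rw [← Finset.sum_div, Finset.sum_add_distrib,
    sum_box_neg N fun k => ext a k * ((w k).re - (w k).im)]
  ring

lemma sum_boxNZ (N : ℕ) (τ : ℍ) (φ : H1) (r : ℝ) (a : Sample) :
    ∑ k ∈ boxNZ N, fieldShift τ φ r k * a k =
      r * ∑ k ∈ box N, (alphaGauss a k * conj (cmCoeff τ φ k)).re := by
  rw [sum_box_alphaGauss a N (cmCoeff_neg τ φ), Finset.mul_sum]
  let f : Freq → ℝ := fun k => r * (ext a k * ((cmCoeff τ φ k).re - (cmCoeff τ φ k).im))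
  have h1 : ∑ k ∈ boxNZ N, fieldShift τ φ r k * a k = ∑ k ∈ boxNZ N, f k := by
    refine Finset.sum_congr rfl fun k _ => ?_
    simp only [f, fieldShift, ext, dif_pos k.2]
    ring
  rw [h1, boxNZ, Finset.sum_subtype_eq_sum_filter (f := f), Finset.sum_filter]
  refine Finset.sum_congr rfl fun k _ => ?_
  split_ifs with hk
  · rfl
  · simp [not_not.1 hk, cmCoeff_zero]

lemma laplaceCoeff_zero (τ : ℍ) (φ : H1) : laplaceCoeff τ φ 0 = 0 := by simp [laplaceCoeff]

/-- The symbol of `-Δ_τ` is `2π / (Im τ c_k)`; multiplied by the factor `√c_k` of the field it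
leaves `1 / √c_k`, the weight in `cmCoeff`. -/
lemma gff_mul_laplaceCoeff (τ : ℍ) (φ : H1) (a : Sample) (k : Freq) :
    (gff τ a k * conj (-laplaceCoeff τ φ k)).re =
      2 * Real.pi / τ.im * (alphaGauss a k * conj (cmCoeff τ φ k)).re := by
  by_cases hk : k = 0
  · simp [hk, laplaceCoeff_zero, cmCoeff_zero]
  have hc := greenCoeff_pos τ hk
  have hs := Real.sqrt_pos.2 hc
  have hτ := τ.im_pos
  have hn : ‖(τ : ℂ)‖ ^ 2 * (k 0 : ℝ) ^ 2 - 2 * τ.re * (k 0 : ℝ) * (k 1 : ℝ) + (k 1 : ℝ) ^ 2 =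
      τ.im / (2 * Real.pi * greenCoeff τ k) := by
    have h1 := norm_pos_iff.2 (freq_ne_zero τ hk)
    have h2 : τ.im / (2 * Real.pi * greenCoeff τ k) =
        ‖(k 0 : ℂ) * (τ : ℂ) - (k 1 : ℂ)‖ ^ 2 := by
      rw [greenCoeff]; field_simp
    rw [h2, ← Complex.normSq_eq_norm_sq, ← Complex.normSq_eq_norm_sq, Complex.normSq_apply,
      Complex.normSq_apply]
    simp
    ring
  have hreal : (4 * Real.pi ^ 2) * (τ.im ^ 2)⁻¹ * (τ.im / (2 * Real.pi * greenCoeff τ k)) *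
      Real.sqrt (greenCoeff τ k) = 2 * Real.pi / τ.im / Real.sqrt (greenCoeff τ k) := by
    have h3 : greenCoeff τ k = Real.sqrt (greenCoeff τ k) ^ 2 := (Real.sq_sqrt hc.le).symm
    set s := Real.sqrt (greenCoeff τ k)
    rw [h3]
    field_simp
    ring
  have key : gff τ a k * conj (-laplaceCoeff τ φ k) =
      ((2 * Real.pi / τ.im : ℝ) : ℂ) * (alphaGauss a k * conj (cmCoeff τ φ k)) := by
    simp only [gff, hk, if_false, laplaceCoeff, hn, cmCoeff, map_neg, map_mul, map_div₀,
      Complex.conj_ofReal]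
    have h4 := congrArg (fun x : ℝ => (x : ℂ)) hreal
    simp only [Complex.ofReal_mul, Complex.ofReal_div (2 * Real.pi / τ.im)] at h4
    simp only [Complex.ofReal_mul, Complex.ofReal_neg] at h4 ⊢
    linear_combination alphaGauss a k * conj (φ.coeff k) * h4
  rw [key, Complex.re_ofReal_mul]

/-- Gauss–Bonnet on the torus: the curvature term does not see constants. -/
lemma curvatureIntegral_add_const (τ : ℍ) (φ : H1) (c : ℝ) (f : Freq → ℂ) :
    curvatureIntegral τ φ (constCoeff c + f) = curvatureIntegral τ φ f := by
  unfold curvatureIntegral pairing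
  have : ∀ k, (constCoeff c + f) k * conj (-laplaceCoeff τ φ k) =
      f k * conj (-laplaceCoeff τ φ k) := by
    intro k
    by_cases hk : k = 0
    · simp [hk, laplaceCoeff_zero]
    · simp [constCoeff, hk]
  simp_rw [this]

/-- The curvature term is exactly the Girsanov exponent for the shift by `-(Q/2) φ`, because
`-(Q/4π) · Im τ · (2π / Im τ) = -Q/2`. Both sides are limits along the same squares; convergence is
needed to pull the constant out of `limUnder`. -/
lemma curvatureIntegral_gff (γ : ℝ) (hγ : 0 < γ) (τ : ℍ) (φ : H1) (a : Sample)
    (ha : ∃ l, Tendsto (fun N => ∑ k ∈ boxNZ N, fieldShift τ φ (-(bigQ γ / 2)) k * a k) atTop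
      (𝓝 l)) :
    -(bigQ γ / (4 * Real.pi)) * curvatureIntegral τ φ (gff τ a) =
      limUnder atTop fun N => ∑ k ∈ boxNZ N, fieldShift τ φ (-(bigQ γ / 2)) k * a k := by
  have hQ : 0 < bigQ γ := by unfold bigQ; positivity
  have hτ := τ.im_pos
  have hlim := tendsto_nhds_limUnder ha
  set l := limUnder atTop fun N => ∑ k ∈ boxNZ N, fieldShift τ φ (-(bigQ γ / 2)) k * a k
  have h1 : ∀ N, (∑ k ∈ box N, gff τ a k * conj (-laplaceCoeff τ φ k)).re =
      (-(4 * Real.pi) / (bigQ γ * τ.im)) *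
        ∑ k ∈ boxNZ N, fieldShift τ φ (-(bigQ γ / 2)) k * a k := by
    intro N
    rw [sum_boxNZ, Complex.re_sum]
    simp_rw [gff_mul_laplaceCoeff]
    rw [← Finset.mul_sum]
    field_simp
    ring
  unfold curvatureIntegral pairing
  simp_rw [h1]
  rw [(hlim.const_mul _).limUnder_eq]
  field_simp

lemma curvatureIntegral_zero (τ : ℍ) (f : Freq → ℂ) : curvatureIntegral τ 0 f = 0 := by
  have : Tendsto (fun _ : ℕ => (0 : ℝ)) atTop (𝓝 0) := tendsto_const_nhds
  simp [curvatureIntegral, pairing, laplaceCoeff, H1.coeff_of_zero, this.limUnder_eq]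

/-! ### Measurability of the mean -/

lemma measurable_gff (τ : ℍ) (k : Freq) : Measurable fun a => gff τ a k := by
  have hext : ∀ k, Measurable fun a : Sample => ext a k := by
    intro k
    unfold ext
    split_ifs
    · exact measurable_pi_apply _
    · exact measurable_const
  unfold gff
  split_ifs
  · exact measurable_const
  · refine Measurable.mul_const ?_ _
    unfold alphaGauss
    exact ((Complex.measurable_ofReal.comp ((hext k).add (hext (-k)))).add
      ((Complex.measurable_ofReal.comp ((hext (-k)).sub (hext k))).const_mul _)).div_const _

lemma measurable_meanMetric_gff (τ : ℍ) (φ : H1) :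
    Measurable fun a => meanMetric τ φ (gff τ a) := by
  unfold meanMetric pairing
  refine Measurable.div_const (Measurable.const_mul (measurable_limUnder_nat fun N => ?_) _) _
  exact Complex.measurable_re.comp
    (Finset.measurable_sum _ fun k _ => (measurable_gff τ k).mul_const _)

/-! ### Changes of variables in the zero mode and in the Gaussian field -/

instance : IsProbabilityMeasure gaussLaw := by unfold gaussLaw; infer_instance

/-- The translation of the zero mode by a function of the sample. -/
def zeroModeShear (m : Sample → ℝ) (hm : Measurable m) : ℝ × Sample ≃ᵐ ℝ × Sample where
  toFun p := (p.1 + m p.2, p.2)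
  invFun p := (p.1 - m p.2, p.2)
  left_inv p := by simp
  right_inv p := by simp
  measurable_toFun := (measurable_fst.add (hm.comp measurable_snd)).prodMk measurable_snd
  measurable_invFun := (measurable_fst.sub (hm.comp measurable_snd)).prodMk measurable_snd

/-- For each fixed sample the map translates Lebesgue measure. The swaps only put the sample first,
as a skew product requires. -/
lemma measurePreserving_zeroModeShear (m : Sample → ℝ) (hm : Measurable m) :
    MeasurePreserving (zeroModeShear m hm) zeroModeGauss zeroModeGauss := by
  have h1 : MeasurePreserving (fun p : Sample × ℝ => (p.1, p.2 + m p.1))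
      (gaussLaw.prod volume) (gaussLaw.prod volume) :=
    (MeasurePreserving.id gaussLaw).skew_product (g := fun a c => c + m a)
      (measurable_snd.add (hm.comp measurable_fst))
      (ae_of_all _ fun a => map_add_right_eq_self volume (m a))
  exact (Measure.measurePreserving_swap.comp h1).comp Measure.measurePreserving_swap

/-- The shear is a measurable equivalence, so `f` need not be measurable. The same device serves for
`integrable_girsanov`. -/
lemma integrable_comp_zeroModeShear {m : Sample → ℝ} (hm : Measurable m) (f : ℝ × Sample → ℝ) :
    Integrable (fun p => f (p.1 + m p.2, p.2)) zeroModeGauss ↔ Integrable f zeroModeGauss :=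
  (measurePreserving_zeroModeShear m hm).integrable_comp_emb
    (zeroModeShear m hm).measurableEmbedding

lemma integral_comp_zeroModeShear {m : Sample → ℝ} (hm : Measurable m) (f : ℝ × Sample → ℝ) :
    ∫ p, f (p.1 + m p.2, p.2) ∂zeroModeGauss = ∫ p, f p ∂zeroModeGauss :=
  (measurePreserving_zeroModeShear m hm).integral_comp (zeroModeShear m hm).measurableEmbedding f

/-- The translation of the Gaussian coordinates. -/
def sampleShift (h : Sample) : ℝ × Sample ≃ᵐ ℝ × Sample where
  toFun p := (p.1, p.2 + h)
  invFun p := (p.1, p.2 - h)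
  left_inv p := by simp
  right_inv p := by simp
  measurable_toFun := measurable_fst.prodMk (measurable_snd.add_const h)
  measurable_invFun := measurable_fst.prodMk (measurable_snd.sub_const h)

/-- The Girsanov density along `h`, the exponential series being summed over squares. -/
def girsanovDensity (h : Sample) (a : Sample) : ℝ :=
  Real.exp ((limUnder atTop fun N => ∑ k ∈ boxNZ N, h k * a k) - (∑' k, h k ^ 2) / 2)

lemma measurable_girsanovDensity (h : Sample) : Measurable (girsanovDensity h) :=
  ((measurable_limUnder_nat fun N => by fun_prop).sub_const _).exp

lemma map_sampleShift {h : Sample} (hh : Summable fun k => h k ^ 2) :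
    zeroModeGauss.map (sampleShift h) =
      zeroModeGauss.withDensity fun p => ENNReal.ofReal (girsanovDensity h p.2) := by
  have h1 : gaussLaw.map (fun a => a + h) =
      gaussLaw.withDensity fun a => ENNReal.ofReal (girsanovDensity h a) :=
    stdGaussian_map_add hh boxNZ_mono exists_mem_boxNZ
  have h2 := Measure.map_prod_map (volume : Measure ℝ) gaussLaw measurable_id
    (measurable_id.add_const h)
  have h3 := prod_withDensity_right (μ := (volume : Measure ℝ)) (ν := gaussLaw)
    (measurable_girsanovDensity h).ennreal_ofReal
  unfold zeroModeGauss
  rw [← h3, ← h1]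
  refine Eq.trans ?_ (h2.symm.trans ?_)
  · rfl
  · rw [Measure.map_id]; rfl

lemma integrable_girsanov {h : Sample} (hh : Summable fun k => h k ^ 2) (f : ℝ × Sample → ℝ) :
    Integrable (fun p => girsanovDensity h p.2 * f p) zeroModeGauss ↔
      Integrable (fun p => f (p.1, p.2 + h)) zeroModeGauss := by
  have h1 := (sampleShift h).measurableEmbedding.integrable_map_iff (μ := zeroModeGauss) (g := f)
  have hD : Measurable fun p : ℝ × Sample => ENNReal.ofReal (girsanovDensity h p.2) :=
    ((measurable_girsanovDensity h).comp measurable_snd).ennreal_ofReal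
  rw [map_sampleShift hh, integrable_withDensity_iff_integrable_smul' hD
    (ae_of_all _ fun _ => ENNReal.ofReal_lt_top)] at h1
  simp only [girsanovDensity, ENNReal.toReal_ofReal (Real.exp_pos _).le, smul_eq_mul] at h1
  exact h1

lemma integral_girsanov {h : Sample} (hh : Summable fun k => h k ^ 2) (f : ℝ × Sample → ℝ) :
    ∫ p, girsanovDensity h p.2 * f p ∂zeroModeGauss =
      ∫ p, f (p.1, p.2 + h) ∂zeroModeGauss := by
  have h1 := (sampleShift h).measurableEmbedding.integral_map (μ := zeroModeGauss) f
  have hD : Measurable fun p : ℝ × Sample => ENNReal.ofReal (girsanovDensity h p.2) :=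
    ((measurable_girsanovDensity h).comp measurable_snd).ennreal_ofReal
  rw [map_sampleShift hh, integral_withDensity_eq_integral_toReal_smul hD
    (ae_of_all _ fun _ => ENNReal.ofReal_lt_top)] at h1
  simp only [girsanovDensity, ENNReal.toReal_ofReal (Real.exp_pos _).le, smul_eq_mul] at h1
  exact h1

/-! ### The Weyl anomaly at fixed regularisation -/

/-- The part of the integrand of the partition function that depends on the Liouville field `f`
only. -/
def fieldWeight (γ μ : ℝ) {n : ℕ} (z : Fin n → Torus) (α : Fin n → ℝ) (τ : ℍ)
    (F : HNegOne → ℝ) (ε : ℝ) (f : Freq → ℂ) : ℝ :=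
  F (toHNegOne (circleAverage τ ε f)) *
    (∏ i, ε ^ (α i ^ 2 / 2) * Real.exp (α i * evalAt (circleAverage τ ε f) (z i))) *
    Real.exp (-(μ * ε ^ (γ ^ 2 / 2) *
      ∫ x, Real.exp (γ * evalAt (circleAverage τ ε f) x) ∂(volTau τ)))

/-- The field `c + X_τ - (Q/2) ln(Im τ)`. -/
def flatField (γ : ℝ) (τ : ℍ) (p : ℝ × Sample) : Freq → ℂ :=
  constCoeff p.1 + gff τ p.2 - constCoeff (bigQ γ / 2 * Real.log τ.im)

lemma constCoeff_add (r s : ℝ) : constCoeff (r + s) = constCoeff r + constCoeff s := by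
  funext k; simp only [constCoeff, Pi.add_apply]; split_ifs <;> simp

lemma liouvilleField_shear (γ : ℝ) (τ : ℍ) (φ : H1) (p : ℝ × Sample) :
    liouvilleField γ τ φ (p.1 + meanMetric τ φ (gff τ p.2)) p.2 =
      flatField γ τ p + fun k => ((bigQ γ / 2 : ℝ) : ℂ) * φ.coeff k := by
  unfold liouvilleField flatField gffMetric
  rw [constCoeff_add]
  abel

variable (γ μ : ℝ) {n : ℕ} (z : Fin n → Torus) (α : Fin n → ℝ) (τ : ℍ) (φ : H1)
  (F : HNegOne → ℝ) (ε : ℝ)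

/-- Translating `c` by the mean undoes the recentring of `X_g`, after which the metric enters only
through the curvature factor and the additive term `(Q/2) φ`. -/
lemma liouvilleIntegrand_shear (p : ℝ × Sample) :
    liouvilleIntegrand γ μ z α τ φ F ε (p.1 + meanMetric τ φ (gff τ p.2), p.2) =
      Real.exp (-(bigQ γ / (4 * Real.pi)) * curvatureIntegral τ φ (gff τ p.2)) *
        fieldWeight γ μ z α τ F ε
          (flatField γ τ p + fun k => ((bigQ γ / 2 : ℝ) : ℂ) * φ.coeff k) := by
  have h1 : constCoeff (p.1 + meanMetric τ φ (gff τ p.2)) + gffMetric τ φ p.2 =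
      constCoeff p.1 + gff τ p.2 := by
    rw [constCoeff_add, gffMetric]; abel
  simp only [liouvilleIntegrand, liouvilleFieldReg, fieldWeight, liouvilleField_shear, h1,
    curvatureIntegral_add_const, sub_eq_add_neg, Real.exp_add]
  ring

lemma liouvilleIntegrand_shear_zero (p : ℝ × Sample) :
    liouvilleIntegrand γ μ z α τ 0 F ε (p.1 + meanMetric τ 0 (gff τ p.2), p.2) =
      fieldWeight γ μ z α τ F ε (flatField γ τ p) := by
  have h1 : (fun k => ((bigQ γ / 2 : ℝ) : ℂ) * H1.coeff 0 k) = 0 := by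
    funext k; simp [H1.coeff_of_zero]
  rw [liouvilleIntegrand_shear, h1, curvatureIntegral_zero]
  simp

/-- The Gaussian shift removes all non-zero frequencies of `(Q/2) φ`; its mean survives as a
translation of the zero mode. -/
lemma flatField_shift (p : ℝ × Sample) :
    flatField γ τ (p.1, p.2 + fieldShift τ φ (-(bigQ γ / 2))) +
        (fun k => ((bigQ γ / 2 : ℝ) : ℂ) * φ.coeff k) =
      flatField γ τ (p.1 + bigQ γ / 2 * (φ.coeff 0).re, p.2) := by
  funext k
  simp only [flatField, Pi.add_apply, Pi.sub_apply, gff_add_fieldShift, constCoeff]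
  split_ifs <;> push_cast <;> ring

lemma tsum_fieldShift_sq :
    (∑' k, fieldShift τ φ (-(bigQ γ / 2)) k ^ 2) / 2 =
      6 * bigQ γ ^ 2 / (96 * Real.pi) * dirichletEnergy τ φ := by
  rw [(hasSum_fieldShift_sq τ φ _).tsum_eq]
  field_simp
  ring

/-- Completing the exponent to a normalised density costs half its variance, which is the anomaly.
The identity is only almost sure, since the curvature series converges almost surely. -/
lemma liouvilleIntegrand_shear_ae (hγ : 0 < γ) :
    (fun p : ℝ × Sample =>
      liouvilleIntegrand γ μ z α τ φ F ε (p.1 + meanMetric τ φ (gff τ p.2), p.2))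
      =ᵐ[zeroModeGauss] fun p =>
        Real.exp (6 * bigQ γ ^ 2 / (96 * Real.pi) * dirichletEnergy τ φ) *
          (girsanovDensity (fieldShift τ φ (-(bigQ γ / 2))) p.2 *
            fieldWeight γ μ z α τ F ε
              (flatField γ τ p + fun k => ((bigQ γ / 2 : ℝ) : ℂ) * φ.coeff k)) := by
  have h1 : ∀ᵐ a ∂gaussLaw, ∃ l, Tendsto
      (fun N => ∑ k ∈ boxNZ N, fieldShift τ φ (-(bigQ γ / 2)) k * a k) atTop (𝓝 l) :=
    ae_exists_tendsto_sum_stdGaussian (hasSum_fieldShift_sq τ φ _).summable boxNZ_mono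
  have h2 := Measure.quasiMeasurePreserving_snd (μ := (volume : Measure ℝ)) (ν := gaussLaw)
  filter_upwards [h2.ae h1] with p hp
  rw [liouvilleIntegrand_shear, curvatureIntegral_gff γ hγ τ φ p.2 hp, ← mul_assoc,
    girsanovDensity, tsum_fieldShift_sq, ← Real.exp_add, add_sub_cancel]

/-- The partition function of `g = e^φ ĝ_τ` at scale `ε` is that of `ĝ_τ`, up to the anomaly. -/
theorem weyl_anomaly_reg (hγ : 0 < γ) :
    (Integrable (liouvilleIntegrand γ μ z α τ φ F ε) zeroModeGauss ↔
      Integrable (liouvilleIntegrand γ μ z α τ 0 F ε) zeroModeGauss) ∧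
    ∫ p, liouvilleIntegrand γ μ z α τ φ F ε p ∂zeroModeGauss =
      Real.exp (6 * bigQ γ ^ 2 / (96 * Real.pi) * dirichletEnergy τ φ) *
        ∫ p, liouvilleIntegrand γ μ z α τ 0 F ε p ∂zeroModeGauss := by
  have hh := (hasSum_fieldShift_sq τ φ (-(bigQ γ / 2))).summable
  have hae := liouvilleIntegrand_shear_ae γ μ z α τ φ F ε hγ
  have hconst : Measurable fun _ : Sample => bigQ γ / 2 * (φ.coeff 0).re := measurable_const
  have h0 := liouvilleIntegrand_shear_zero γ μ z α τ F ε
  constructor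
  · refine (integrable_comp_zeroModeShear (measurable_meanMetric_gff τ φ) _).symm.trans ?_
    -- The reference integrand is sheared too, so both sides become integrals of `fieldWeight` along
    -- the flat field, without evaluating the flat mean of `X_τ`.
    refine Iff.trans ?_ (integrable_comp_zeroModeShear (measurable_meanMetric_gff τ 0) _)
    rw [integrable_congr hae, integrable_const_mul_iff (Real.exp_pos _).ne'.isUnit,
      integrable_girsanov hh]
    simp_rw [h0, flatField_shift]
    exact integrable_comp_zeroModeShear hconst
      fun p => fieldWeight γ μ z α τ F ε (flatField γ τ p)
  · refine (integral_comp_zeroModeShear (measurable_meanMetric_gff τ φ) _).symm.trans ?_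
    rw [integral_congr_ae hae, integral_const_mul, integral_girsanov hh]
    congr 1
    refine Eq.trans ?_ (integral_comp_zeroModeShear (measurable_meanMetric_gff τ 0) _)
    simp_rw [h0, flatField_shift]
    exact integral_comp_zeroModeShear hconst
      fun p => fieldWeight γ μ z α τ F ε (flatField γ τ p)

/-- The `1` comes from the free field partition function, the `6Q²` from the Girsanov normalisation.
-/
lemma partitionReg_eq (hγ : 0 < γ) : partitionReg γ μ z α τ φ F ε =
    Real.exp ((1 + 6 * bigQ γ ^ 2) / (96 * Real.pi) * dirichletEnergy τ φ) *
      partitionReg γ μ z α τ 0 F ε := by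
  unfold partitionReg
  rw [(weyl_anomaly_reg γ μ z α τ φ F ε hγ).2, freePartition_eq]
  have h : (1 + 6 * bigQ γ ^ 2) / (96 * Real.pi) * dirichletEnergy τ φ =
      dirichletEnergy τ φ / (96 * Real.pi) +
        6 * bigQ γ ^ 2 / (96 * Real.pi) * dirichletEnergy τ φ := by ring
  rw [h, Real.exp_add]
  ring

/-- The Weyl anomaly: the limits for `e^φ ĝ_τ` and for `ĝ_τ` are proportional. -/
theorem isNontrivialPartition_iff (hγ : 0 < γ) (L : ℝ) :
    IsNontrivialPartition γ μ z α τ φ F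
        (Real.exp ((1 + 6 * bigQ γ ^ 2) / (96 * Real.pi) * dirichletEnergy τ φ) * L) ↔
      IsNontrivialPartition γ μ z α τ 0 F L := by
  have h1 : partitionReg γ μ z α τ φ F = fun ε =>
      Real.exp ((1 + 6 * bigQ γ ^ 2) / (96 * Real.pi) * dirichletEnergy τ φ) *
        partitionReg γ μ z α τ 0 F ε := funext fun ε => partitionReg_eq γ μ z α τ φ F ε hγ
  have hK := Real.exp_pos ((1 + 6 * bigQ γ ^ 2) / (96 * Real.pi) * dirichletEnergy τ φ)
  unfold IsNontrivialPartition
  simp_rw [fun ε => (weyl_anomaly_reg γ μ z α τ φ F ε hγ).1]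
  rw [h1, mul_pos_iff_of_pos_left hK]
  exact and_congr_right fun _ => and_congr_right fun _ => tendsto_const_smul_iff₀ hK.ne'

end LQFT

end

/-! ### The Weyl anomaly and the central charge. -/

theorem mainTheorem2 (γ μ : ℝ) (hγ : 0 < γ) (hγ' : γ < 2) (hμ : 0 < μ)
    {n : ℕ} (z : Fin n → LQFT.Torus) (hz : Function.Injective z) (α : Fin n → ℝ)
    (φ : UpperHalfPlane → LQFT.H1) (hφ : LQFT.IsModularLogConformalFactor φ)
    (τ : UpperHalfPlane)
    (F : LQFT.HNegOne → ℝ) (hF : Measurable[borel LQFT.HNegOne] F) (hFb : ∃ C, ∀ h, |F h| ≤ C) :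
    ((∃ L, LQFT.IsNontrivialPartition γ μ z α τ (φ τ) F L) ↔
      (∃ L, LQFT.IsNontrivialPartition γ μ z α τ 0 F L)) ∧
    ∀ L L₀ : ℝ, LQFT.IsNontrivialPartition γ μ z α τ (φ τ) F L →
      LQFT.IsNontrivialPartition γ μ z α τ 0 F L₀ →
      Real.log (L / L₀) =
        (1 + 6 * LQFT.bigQ γ ^ 2) / (96 * Real.pi) * LQFT.dirichletEnergy τ (φ τ) ∧
      (LQFT.dirichletEnergy τ (φ τ) ≠ 0 → ∀ cL : ℝ,
        Real.log (L / L₀) = cL / (96 * Real.pi) * LQFT.dirichletEnergy τ (φ τ) →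
        cL = 1 + 6 * LQFT.bigQ γ ^ 2) := by
  have key := LQFT.isNontrivialPartition_iff γ μ z α τ (φ τ) F hγ
  refine ⟨⟨?_, fun ⟨L, hL⟩ => ⟨_, (key L).2 hL⟩⟩, fun L L₀ hL hL₀ => ?_⟩
  · rintro ⟨L, hL⟩
    refine ⟨(Real.exp ((1 + 6 * LQFT.bigQ γ ^ 2) / (96 * Real.pi) *
      LQFT.dirichletEnergy τ (φ τ)))⁻¹ * L, (key _).1 ?_⟩
    rwa [mul_inv_cancel_left₀ (Real.exp_pos _).ne']
  · have hlog : Real.log (L / L₀) =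
        (1 + 6 * LQFT.bigQ γ ^ 2) / (96 * Real.pi) * LQFT.dirichletEnergy τ (φ τ) := by
      -- Uniqueness of limits forces `L` to be the anomaly factor times `L₀`, and `L₀ > 0` allows
      -- the division.
      rw [tendsto_nhds_unique hL.2.2 ((key L₀).2 hL₀).2.2, mul_div_cancel_right₀ _ hL₀.1.ne',
        Real.log_exp]
    refine ⟨hlog, fun hD cL hcL => ?_⟩
    have h := mul_right_cancel₀ hD (hcL.symm.trans hlog)
    exact (div_left_inj' (by positivity)).1 h
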